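/- Let $A$ be a reduced excellent ring (commutative with one; excellent means Noetherian, universally catenary, with geometrically regular formal fibres at all primes, and such that every finitely generated $A$-algebra has an open regular locus). Let $Q(A)$ be its total ring of fractions and let $$\mathrm{Sing}(A)=\{P\in\mathrm{Spec}(A)\mid A_P\text{ is not a regular local ring}\}.$$ For an ideal $J\subseteq A$ define rings $A\subseteq A_i\subseteq Q(A)$ by $A_0=A$ and $$A_{i+1}=\mathrm{End}_{A_i}\big(\sqrt{JA_i}\big),$$ where, for a ring $A\subseteq B\subseteq Q(A)$ and an ideal $I$ of $B$, $\mathrm{End}_B(I)$ is identified with the subring of all $x\in Q(A)$ such that multiplication by $x$ is a $B$-linear endomorphism of $I$ (if $I$ contains a non-zerodivisor $g$, then $\varphi\in\mathrm{End}_B(I)$ corresponds to $\varphi(g)/g$). Let $n(A,J)\in\mathbb N\cup\{\infty\}$ be the least $n$ with $A_n=A_{n+1}$ ($\infty$ if there is none). For $P\in\mathrm{Sing}(A)$ let $L_P$ be the intersection of all $\widetilde P\in\mathrm{Sing}(A)$ with $\widetilde P\subseteq P$. The strata of $\mathrm{Sing}(A)$ are the non-empty sets $W_L=\{P\in\mathrm{Sing}(A)\mid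 L_P=L\}$; write $\mathrm{Strata}(A)$ for the set of all strata, and $L_W$ for the constant value of $P\mapsto L_P$ on a stratum $W$. Let $J=\bigcap_{P\in\mathrm{Sing}(A)}P$ be the vanishing ideal of $\mathrm{Sing}(A)$. Then $\mathrm{Strata}(A)$ is finite, and $$n(A,J)\le\max_{W\in\mathrm{Strata}(A)}n(A,L_W),$$ where the maximum over the empty set is $0$. If, moreover, $A$ is equidimensional (that is, $\dim A/\mathfrak p=\dim A$ for all minimal primes $\mathfrak p$ of $A$) and satisfies Serre's condition $(S_2)$ (that is, $\mathrm{depth}\,A_P\ge\min\{2,\dim A_P\}$ for all $P\in\mathrm{Spec}(A)$), then equality holds. -/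

import Mathlib

open scoped TensorProduct

universe u

namespace StratNorm

noncomputable section

/-! ### Singular locus, depth, Serre's condition, equidimensionality -/

/-- The singular locus: all primes `P` such that `A_P` is not a regular local ring. -/
def Sing (A : Type u) [CommRing A] : Set (PrimeSpectrum A) :=
  {P | ¬ IsRegularLocalRing (Localization.AtPrime P.asIdeal)}

/-- The depth of a local ring: the supremum of the lengths of the regular sequences in its
maximal ideal. -/
def depth (R : Type u) [CommRing R] [IsLocalRing R] : ℕ∞ :=
  ⨆ (rs : List R) (_ : (∀ r ∈ rs, r ∈ IsLocalRing.maximalIdeal R) ∧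
    RingTheory.Sequence.IsRegular R rs), (rs.length : ℕ∞)

/-- Serre's condition `(S_i)`: `depth R_P ≥ min {i, dim R_P}` for all primes `P`. -/
def SerreS (i : ℕ) (R : Type u) [CommRing R] : Prop :=
  ∀ P : PrimeSpectrum R,
    min ((i : ℕ∞) : WithBot ℕ∞) (ringKrullDim (Localization.AtPrime P.asIdeal)) ≤
      (depth (Localization.AtPrime P.asIdeal) : WithBot ℕ∞)

/-- All irreducible components of the spectrum have the same dimension. -/
def IsEquidimensional (R : Type u) [CommRing R] : Prop :=
  ∀ p ∈ minimalPrimes R, ringKrullDim (R ⧸ p) = ringKrullDim R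

/-! ### Excellent rings -/

/-- Any two saturated chains of primes with the same end points have the same length. -/
def IsCatenary (R : Type u) [CommRing R] : Prop :=
  ∀ s t : RelSeries {(P, Q) : PrimeSpectrum R × PrimeSpectrum R | P ⋖ Q},
    s.head = t.head → s.last = t.last → s.length = t.length

/-- For a local ring `R`: the formal fibres `κ(q) ⊗ R̂` are geometrically regular over `κ(q)`,
that is, they stay regular under every finite extension of `κ(q)`. -/
def HasGeomRegularFormalFibres (R : Type u) [CommRing R] [IsLocalRing R] : Prop :=
  ∀ (q : Ideal R) [q.IsPrime] (L : Type u) [Field L] [Algebra q.ResidueField L]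
    [Module.Finite q.ResidueField L],
    IsRegularRing
      (L ⊗[q.ResidueField] (q.ResidueField ⊗[R] AdicCompletion (IsLocalRing.maximalIdeal R) R))

/-- Excellent rings: Noetherian, universally catenary, with geometrically regular formal fibres
at all primes (G-ring), and such that every finitely generated algebra has an open regular locus
(J-2). -/
structure IsExcellentRing (A : Type u) [CommRing A] : Prop where
  isNoetherianRing : IsNoetherianRing A
  catenary : ∀ (B : Type u) [CommRing B] [Algebra A B] [Algebra.FiniteType A B], IsCatenary B
  formalFibres : ∀ P : PrimeSpectrum A,
    HasGeomRegularFormalFibres (Localization.AtPrime P.asIdeal)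
  isOpen_regularLocus : ∀ (B : Type u) [CommRing B] [Algebra A B] [Algebra.FiniteType A B],
    IsOpen (Sing B)ᶜ

/-! ### The normalization algorithm -/

/-- For a ring `A ⊆ B ⊆ Q(A)` and an ideal `I` of `B`, the ring `End_B(I)` seen inside the total
ring of fractions `Q(A)`: all `x` such that multiplication by `x` is a `B`-endomorphism of `I`.
(If `I` contains a non-zerodivisor `g`, every `φ ∈ End_B(I)` is multiplication by the unique
element `φ(g)/g`.) -/
def endRing {A : Type u} [CommRing A] (B : Subalgebra A (FractionRing A)) (I : Ideal B) :
    Subalgebra A (FractionRing A) where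
  carrier := {x | ∃ φ : Module.End B I, ∀ j : I,
    (((φ j : I) : B) : FractionRing A) = x * ((j : B) : FractionRing A)}
  mul_mem' := by
    rintro x y ⟨φ, hφ⟩ ⟨ψ, hψ⟩
    exact ⟨φ * ψ, fun j => by rw [Module.End.mul_apply, hφ, hψ, mul_assoc]⟩
  add_mem' := by
    rintro x y ⟨φ, hφ⟩ ⟨ψ, hψ⟩
    refine ⟨φ + ψ, fun j => ?_⟩
    rw [add_mul, ← hφ, ← hψ]
    simp
  algebraMap_mem' := by
    intro a
    refine ⟨algebraMap B (Module.End B I) (algebraMap A B a), fun j => ?_⟩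
    rw [Module.algebraMap_end_apply]
    rfl

/-- The rings `A_i`: `A_0 = A` and `A_{i+1} = End_{A_i}(J_i)` with `J_i = √(J A_i)`. -/
def chain {A : Type u} [CommRing A] (J : Ideal A) : ℕ → Subalgebra A (FractionRing A)
  | 0 => ⊥
  | i + 1 => endRing (chain J i) (J.map (algebraMap A (chain J i))).radical

/-- The number of steps `n(A, J)`: the least `n` with `A_n = A_{n+1}` (and `⊤` if there is
none). -/
def numSteps (A : Type u) [CommRing A] (J : Ideal A) : ℕ∞ :=
  ⨅ (n : ℕ) (_ : chain J n = chain J (n + 1)), (n : ℕ∞)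

/-! ### The stratification of the singular locus -/

/-- `L_P`: the intersection of all singular primes contained in `P`. -/
def idealAt (A : Type u) [CommRing A] (P : PrimeSpectrum A) : Ideal A :=
  ⨅ (P' : PrimeSpectrum A) (_ : P' ∈ Sing A ∧ P'.asIdeal ≤ P.asIdeal), P'.asIdeal

/-- `W_L`: all singular primes `P` with `L_P = L`. -/
def stratum (A : Type u) [CommRing A] (L : Ideal A) : Set (PrimeSpectrum A) :=
  {P | P ∈ Sing A ∧ idealAt A P = L}

/-- The set of all strata `W_L`, where `L` runs through the values `L_P`, `P ∈ Sing(A)`. -/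
def Strata (A : Type u) [CommRing A] : Set (Set (PrimeSpectrum A)) :=
  stratum A '' (idealAt A '' Sing A)

/-- `L_W`: the constant value of `P ↦ L_P` on a stratum `W` (written as an intersection). -/
def stratumIdeal (A : Type u) [CommRing A] (W : Set (PrimeSpectrum A)) : Ideal A :=
  ⨅ P ∈ W, idealAt A P

theorem stratumIdeal_eq (A : Type u) [CommRing A] {W : Set (PrimeSpectrum A)} (hW : W ∈ Strata A)
    {P : PrimeSpectrum A} (hP : P ∈ W) : stratumIdeal A W = idealAt A P := by
  obtain ⟨L, -, rfl⟩ := hW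
  refine le_antisymm (iInf₂_le P hP) (le_iInf₂ fun P' hP' => ?_)
  rw [hP.2, hP'.2]

end

end StratNorm

open scoped Pointwise

namespace StratNorm

variable {A : Type u} [CommRing A]

/-! ### Local comparison of submodules -/

/-! The algorithm commutes with localization. Since `A` is reduced, its minimal primes are regular
points, so by prime avoidance `J` contains a non-zerodivisor; hence all `A_i` and their radical
ideals are finite `A`-modules, and ideals that agree at `Q` yield chains that agree at `Q`
(`LocLE.chain`). By `locLE_idealAt`, `J` and `L_P` agree at `P`. If every chain for `L_P` is stable
at step `n`, the chain for `J` is therefore stable at `n` at each singular prime; at regular primes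
the ideal is the unit ideal and nothing moves. This gives finiteness-free `≤`. For `≥`, `(S_2)` lets
`A`, and then every `A_i`, be tested at primes `Q` of height at most one. If `L ⊆ Q`, then `Q` is
singular with `L_Q = Q`, so `L` and `J` agree at `Q`; otherwise `L` is trivial at `Q`. -/

/-- `M` is contained in `N` after localization at `Q`. -/
def LocLE {V : Type*} [AddCommGroup V] [Module A V] (Q : Ideal A) (M N : Submodule A V) : Prop :=
  ∀ m ∈ M, ∃ s ∉ Q, s • m ∈ N

section LocLE

variable {V : Type*} [AddCommGroup V] [Module A V] {Q : Ideal A} {M N N' : Submodule A V}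

theorem LocLE.of_le [Q.IsPrime] (h : M ≤ N) : LocLE Q M N := fun m hm =>
  ⟨1, (Ideal.ne_top_iff_one Q).mp Ideal.IsPrime.ne_top', by simpa using h hm⟩

theorem LocLE.trans [hQ : Q.IsPrime] (h : LocLE Q M N) (h' : LocLE Q N N') : LocLE Q M N' := by
  intro m hm
  obtain ⟨s, hs, hsm⟩ := h m hm
  obtain ⟨t, ht, htm⟩ := h' _ hsm
  exact ⟨t * s, hQ.mul_notMem ht hs, by rwa [mul_smul]⟩

/-- Finitely many generators have a common denominator: the product of theirs. -/
theorem LocLE.exists_smul_mem [hQ : Q.IsPrime] (hM : M.FG) (h : LocLE Q M N) :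
    ∃ s ∉ Q, ∀ m ∈ M, s • m ∈ N := by
  induction M, hM using Submodule.fg_induction with
  | singleton x =>
    obtain ⟨s, hs, hx⟩ := h x (Submodule.mem_span_singleton_self x)
    refine ⟨s, hs, fun m hm => ?_⟩
    obtain ⟨a, rfl⟩ := Submodule.mem_span_singleton.mp hm
    rw [smul_comm]
    exact N.smul_mem a hx
  | sup M₁ M₂ _ _ ih₁ ih₂ =>
    obtain ⟨s, hs, h₁⟩ := ih₁ fun m hm => h m (Submodule.mem_sup_left hm)
    obtain ⟨t, ht, h₂⟩ := ih₂ fun m hm => h m (Submodule.mem_sup_right hm)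
    refine ⟨s * t, hQ.mul_notMem hs ht, fun m hm => ?_⟩
    obtain ⟨y, hy, z, hz, rfl⟩ := Submodule.mem_sup.mp hm
    rw [smul_add]
    refine N.add_mem ?_ ?_
    · rw [mul_comm, mul_smul]
      exact N.smul_mem t (h₁ y hy)
    · rw [mul_smul]
      exact N.smul_mem s (h₂ z hz)

theorem le_of_forall_locLE (h : ∀ (Q : Ideal A) [Q.IsPrime], LocLE Q M N) : M ≤ N := by
  intro m hm
  by_contra hmN
  -- The ideal of all `a` with `a • m ∈ N`.
  have hne : N.comap (LinearMap.toSpanSingleton A V m) ≠ ⊤ := by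
    rw [Ideal.ne_top_iff_one]
    simpa using hmN
  obtain ⟨Q, hQ, hle⟩ := Ideal.exists_le_maximal _ hne
  have := hQ.isPrime
  obtain ⟨s, hs, hsm⟩ := h Q m hm
  exact hs (hle (by simpa using hsm))

end LocLE

/-! ### The chain of rings -/

/-- The ideal `√(JB)` of `B`, as an `A`-submodule of the total ring of fractions. -/
def radicalExt (B : Subalgebra A (FractionRing A)) (J : Ideal A) :
    Submodule A (FractionRing A) :=
  ((J.map (algebraMap A B)).radical.restrictScalars A).map B.val.toLinearMap

theorem mem_radicalExt {B : Subalgebra A (FractionRing A)} {J : Ideal A} {y : FractionRing A} :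
    y ∈ radicalExt B J ↔
      ∃ h : y ∈ B, ∃ n : ℕ, (⟨y, h⟩ : B) ^ n ∈ J.map (algebraMap A B) := by
  constructor
  · rintro ⟨b, hb, rfl⟩
    exact ⟨b.2, hb⟩
  · rintro ⟨h, hn⟩
    exact ⟨⟨y, h⟩, hn, rfl⟩

theorem radicalExt_le (B : Subalgebra A (FractionRing A)) (J : Ideal A) :
    radicalExt B J ≤ B.toSubmodule := fun _ hy => (mem_radicalExt.mp hy).1

theorem algebraMap_mem_radicalExt (B : Subalgebra A (FractionRing A)) {J : Ideal A} {a : A}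
    (ha : a ∈ J) : algebraMap A (FractionRing A) a ∈ radicalExt B J :=
  mem_radicalExt.mpr ⟨B.algebraMap_mem a, 1, by
    rw [pow_one]
    exact Ideal.mem_map_of_mem (algebraMap A B) ha⟩

/-- Linearity is automatic for multiplication by `x`, so stability of the radical ideal is the only
condition. -/
theorem mem_chain_succ {J : Ideal A} {i : ℕ} {x : FractionRing A} :
    x ∈ chain J (i + 1) ↔
      ∀ y ∈ radicalExt (chain J i) J, x * y ∈ radicalExt (chain J i) J := by
  constructor
  · rintro ⟨φ, hφ⟩ _ ⟨b, hb, rfl⟩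
    exact ⟨_, (φ ⟨b, hb⟩).2, hφ ⟨b, hb⟩⟩
  · intro h
    have key : ∀ j : (J.map (algebraMap A (chain J i))).radical,
        ∃ k : (J.map (algebraMap A (chain J i))).radical,
          ((k : chain J i) : FractionRing A) = x * ((j : chain J i) : FractionRing A) := by
      intro j
      obtain ⟨k, hk, hkx⟩ := h _ ⟨j.1, j.2, rfl⟩
      exact ⟨⟨k, hk⟩, hkx⟩
    choose f hf using key
    refine ⟨⟨⟨f, fun a b => ?_⟩, fun c a => ?_⟩, hf⟩
    · apply Subtype.ext
      apply Subtype.ext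
      simp [hf, mul_add]
    · apply Subtype.ext
      apply Subtype.ext
      simp [hf, mul_left_comm]

theorem chain_le_succ (J : Ideal A) (i : ℕ) : chain J i ≤ chain J (i + 1) := by
  intro x hx
  rw [mem_chain_succ]
  rintro _ ⟨b, hb, rfl⟩
  exact ⟨⟨x, hx⟩ * b, Ideal.mul_mem_left _ _ hb, rfl⟩

theorem chain_top (i : ℕ) : chain (⊤ : Ideal A) i = ⊥ := by
  induction i with
  | zero => rfl
  | succ i ih =>
    refine le_antisymm (fun x hx => ?_) bot_le
    rw [← ih]
    have h := mem_chain_succ.mp hx _ (algebraMap_mem_radicalExt (J := ⊤) _ (a := 1) trivial)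
    rw [map_one, mul_one] at h
    exact radicalExt_le _ _ h

theorem chain_eq_succ_of_le {J : Ideal A} {m n : ℕ} (hmn : m ≤ n)
    (h : chain J m = chain J (m + 1)) : chain J n = chain J (n + 1) := by
  induction n, hmn using Nat.le_induction with
  | base => exact h
  | succ n _ ih =>
    exact congrArg (fun B => endRing B (J.map (algebraMap A B)).radical) ih

theorem le_of_forall_natCast_le {a b : ℕ∞} (h : ∀ n : ℕ, b ≤ n → a ≤ n) : a ≤ b := by
  induction b using ENat.recTopCoe with
  | top => exact le_top
  | coe n => exact h n le_rfl

theorem numSteps_le_iff {J : Ideal A} {n : ℕ} :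
    numSteps A J ≤ n ↔ chain J n = chain J (n + 1) := by
  constructor
  · intro h
    have h' : numSteps A J < ((n + 1 : ℕ) : ℕ∞) :=
      h.trans_lt (by exact_mod_cast Nat.lt_succ_self n)
    simp only [numSteps, iInf_lt_iff] at h'
    obtain ⟨m, hm, hlt⟩ := h'
    exact chain_eq_succ_of_le (Nat.lt_succ_iff.mp (by exact_mod_cast hlt)) hm
  · exact fun h => iInf₂_le n h

/-- A submodule that a non-zerodivisor multiplies into a finitely generated one is finitely
generated. -/
theorem fg_of_forall_smul_mem [IsNoetherianRing A] {M N : Submodule A (FractionRing A)}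
    (hN : N.FG) {g : A} (hg : g ∈ nonZeroDivisors A) (h : ∀ x ∈ M, g • x ∈ N) : M.FG := by
  have hN' : IsNoetherian A N := isNoetherian_of_fg_of_noetherian N hN
  let f : M →ₗ[A] N := (LinearMap.lsmul A (FractionRing A) g).restrict h
  have hf : Function.Injective f := by
    intro x y hxy
    have h1 : g • (x : FractionRing A) = g • (y : FractionRing A) := congrArg Subtype.val hxy
    rw [Algebra.smul_def, Algebra.smul_def] at h1
    exact Subtype.ext ((IsLocalization.map_units (FractionRing A)
      (⟨g, hg⟩ : nonZeroDivisors A)).mul_left_cancel h1)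
  have : IsNoetherian A M := isNoetherian_of_injective f hf
  exact Module.Finite.iff_fg.mp inferInstance

/-- Multiplication by `g ∈ J` embeds `A_{i+1}` into `A_i`. -/
theorem chain_fg [IsNoetherianRing A] {J : Ideal A} {g : A} (hg : g ∈ nonZeroDivisors A)
    (hgJ : g ∈ J) (i : ℕ) : (chain J i).toSubmodule.FG := by
  induction i with
  | zero =>
    change (Subalgebra.toSubmodule (⊥ : Subalgebra A (FractionRing A))).FG
    rw [Algebra.toSubmodule_bot, Submodule.one_eq_span]
    exact Submodule.fg_span_singleton 1
  | succ i ih =>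
    refine fg_of_forall_smul_mem ih hg fun x hx => ?_
    rw [Algebra.smul_def, mul_comm]
    exact radicalExt_le _ _ (mem_chain_succ.mp hx _ (algebraMap_mem_radicalExt _ hgJ))

theorem radicalExt_fg [IsNoetherianRing A] {B : Subalgebra A (FractionRing A)}
    (hB : B.toSubmodule.FG) (J : Ideal A) : (radicalExt B J).FG :=
  hB.of_le (radicalExt_le B J)

theorem LocLE.exists_smul_mem_map {Q : Ideal A} [hQ : Q.IsPrime]
    {B B' : Subalgebra A (FractionRing A)} (hB : LocLE Q B.toSubmodule B'.toSubmodule)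
    {J J' : Ideal A} (hJ : LocLE Q J J') {z : B} (hz : z ∈ J.map (algebraMap A B)) :
    ∃ s ∉ Q, ∃ w ∈ J'.map (algebraMap A B'), (w : FractionRing A) = s • (z : FractionRing A) := by
  induction hz using Submodule.span_induction with
  | mem x hx =>
    obtain ⟨a, ha, rfl⟩ := hx
    obtain ⟨s, hs, hsa⟩ := hJ a ha
    refine ⟨s, hs, algebraMap A B' (s • a), Ideal.mem_map_of_mem _ hsa, ?_⟩
    change algebraMap A (FractionRing A) (s • a) = s • algebraMap A (FractionRing A) a
    rw [smul_eq_mul, map_mul, Algebra.smul_def]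
  | zero =>
    exact ⟨1, (Ideal.ne_top_iff_one Q).mp hQ.ne_top, 0, zero_mem _, by simp⟩
  | add x y _ _ ihx ihy =>
    obtain ⟨s, hs, w, hw, hwx⟩ := ihx
    obtain ⟨t, ht, v, hv, hvy⟩ := ihy
    refine ⟨s * t, hQ.mul_notMem hs ht, t • w + s • v,
      add_mem (Submodule.smul_of_tower_mem _ t hw) (Submodule.smul_of_tower_mem _ s hv), ?_⟩
    simp only [AddMemClass.coe_add, SetLike.val_smul, hwx, hvy, smul_add, smul_smul, mul_comm]
  | smul b x _ ih =>
    obtain ⟨s, hs, w, hw, hwx⟩ := ih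
    obtain ⟨t, ht, hb⟩ := hB b b.2
    refine ⟨t * s, hQ.mul_notMem ht hs, ⟨t • (b : FractionRing A), hb⟩ * w,
      Ideal.mul_mem_left _ _ hw, ?_⟩
    simp only [MulMemClass.coe_mul, hwx, smul_eq_mul, smul_mul_smul_comm]

theorem LocLE.radicalExt {Q : Ideal A} [hQ : Q.IsPrime]
    {B B' : Subalgebra A (FractionRing A)} (hB : LocLE Q B.toSubmodule B'.toSubmodule)
    {J J' : Ideal A} (hJ : LocLE Q J J') : LocLE Q (radicalExt B J) (radicalExt B' J') := by
  intro y hy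
  obtain ⟨hyB, n, hn⟩ := mem_radicalExt.mp hy
  obtain ⟨s, hs, hsy⟩ := hB y hyB
  obtain ⟨t, ht, w, hw, hwy⟩ := hB.exists_smul_mem_map hJ hn
  have hmem : (t * s) • y ∈ B' := by
    rw [mul_smul]
    exact B'.smul_mem hsy t
  refine ⟨t * s, hQ.mul_notMem ht hs, mem_radicalExt.mpr ⟨hmem, n + 1, ?_⟩⟩
  -- Exponent `n + 1` also covers `n = 0`: one factor `t` is always left to form `w = t • y ^ n`.
  have heq : (⟨(t * s) • y, hmem⟩ : B') ^ (n + 1) =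
      (algebraMap A B' (t ^ n * s ^ n) * ⟨s • y, hsy⟩) * w := by
    apply Subtype.ext
    have h1 : ((algebraMap A B' (t ^ n * s ^ n) : B') : FractionRing A) =
      algebraMap A (FractionRing A) (t ^ n * s ^ n) := rfl
    simp only [MulMemClass.coe_mul, hwy, h1, SubmonoidClass.coe_pow, Algebra.smul_def]
    simp only [map_mul, map_pow]
    ring
  rw [heq]
  exact Ideal.mul_mem_left _ _ hw

theorem LocLE.chain [IsNoetherianRing A] {Q : Ideal A} [hQ : Q.IsPrime] {J J' : Ideal A}
    (h : LocLE Q J J') (h' : LocLE Q J' J) {g g' : A} (hg : g ∈ nonZeroDivisors A) (hgJ : g ∈ J)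
    (hg' : g' ∈ nonZeroDivisors A) (hgJ' : g' ∈ J') (i : ℕ) :
    LocLE Q (chain J i).toSubmodule (chain J' i).toSubmodule := by
  suffices H : LocLE Q (StratNorm.chain J i).toSubmodule (StratNorm.chain J' i).toSubmodule ∧
      LocLE Q (StratNorm.chain J' i).toSubmodule (StratNorm.chain J i).toSubmodule from H.1
  have step : ∀ {J J' : Ideal A} {g' : A}, LocLE Q J J' → LocLE Q J' J →
      g' ∈ nonZeroDivisors A → g' ∈ J' → ∀ i,
      LocLE Q (StratNorm.chain J i).toSubmodule (StratNorm.chain J' i).toSubmodule →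
      LocLE Q (StratNorm.chain J' i).toSubmodule (StratNorm.chain J i).toSubmodule →
      LocLE Q (StratNorm.chain J (i + 1)).toSubmodule
        (StratNorm.chain J' (i + 1)).toSubmodule := by
    intro J J' g' h h' hg' hgJ' i ih ih' x hx
    -- Carry `y` to the `J` side, multiply by `x`, and carry it back; this uses both inclusions,
    -- hence the simultaneous induction. The denominator depends on `y` until finite generation
    -- makes it uniform.
    have hle : LocLE Q ((StratNorm.radicalExt (StratNorm.chain J' i) J').map
        (LinearMap.mulLeft A x)) (StratNorm.radicalExt (StratNorm.chain J' i) J') := by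
      rintro _ ⟨y, hy, rfl⟩
      obtain ⟨s, hs, hsy⟩ := ih'.radicalExt h' y hy
      obtain ⟨t, ht, hty⟩ := ih.radicalExt h _ (mem_chain_succ.mp hx _ hsy)
      refine ⟨t * s, hQ.mul_notMem ht hs, ?_⟩
      rw [mul_smul, LinearMap.mulLeft_apply, ← mul_smul_comm s]
      exact hty
    obtain ⟨s, hs, hsx⟩ := hle.exists_smul_mem ((radicalExt_fg (chain_fg hg' hgJ' i) J').map _)
    refine ⟨s, hs, mem_chain_succ.mpr fun y hy => ?_⟩
    rw [smul_mul_assoc]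
    exact hsx _ ⟨y, hy, rfl⟩
  induction i with
  | zero => exact ⟨.of_le le_rfl, .of_le le_rfl⟩
  | succ i ih => exact ⟨step h h' hg' hgJ' i ih.1 ih.2, step h' h hg hgJ i ih.2 ih.1⟩

/-! ### Behaviour in codimension one -/

/-- All fractions which lie in `B` locally at every prime of height at most one. -/
def codimOneClosure (B : Subalgebra A (FractionRing A)) : Subalgebra A (FractionRing A) where
  carrier := {x | ∀ (Q : Ideal A) [Q.IsPrime], Q.height ≤ 1 → ∃ s ∉ Q, s • x ∈ B}
  mul_mem' := by
    intro x y hx hy Q hQ hht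
    obtain ⟨s, hs, hsx⟩ := hx Q hht
    obtain ⟨t, ht, hty⟩ := hy Q hht
    refine ⟨s * t, hQ.mul_notMem hs ht, ?_⟩
    rw [← smul_mul_smul_comm]
    exact mul_mem hsx hty
  add_mem' := by
    intro x y hx hy Q hQ hht
    obtain ⟨s, hs, hsx⟩ := hx Q hht
    obtain ⟨t, ht, hty⟩ := hy Q hht
    refine ⟨s * t, hQ.mul_notMem hs ht, ?_⟩
    rw [smul_add]
    refine add_mem ?_ ?_
    · rw [mul_comm, mul_smul]
      exact B.smul_mem hsx t
    · rw [mul_smul]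
      exact B.smul_mem hty s
  algebraMap_mem' := fun a Q hQ _ =>
    ⟨1, (Ideal.ne_top_iff_one Q).mp hQ.ne_top, by
      rw [one_smul]
      exact B.algebraMap_mem a⟩

theorem codimOneClosure_chain_le (h : codimOneClosure (⊥ : Subalgebra A (FractionRing A)) ≤ ⊥)
    (J : Ideal A) (i : ℕ) : codimOneClosure (chain J i) ≤ chain J i := by
  induction i with
  | zero => exact h
  | succ i ih =>
    have hmul : ∀ x ∈ codimOneClosure (chain J (i + 1)), ∀ y ∈ radicalExt (chain J i) J,
        x * y ∈ chain J i := by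
      intro x hx y hy
      refine ih fun Q hQ hht => ?_
      obtain ⟨s, hs, hsx⟩ := hx Q hht
      refine ⟨s, hs, ?_⟩
      rw [← smul_mul_assoc]
      exact radicalExt_le _ _ (mem_chain_succ.mp hsx y hy)
    intro x hx
    refine mem_chain_succ.mpr fun y hy => ?_
    obtain ⟨hyB, n, hn⟩ := mem_radicalExt.mp hy
    refine mem_radicalExt.mpr ⟨hmul x hx y hy, n + 1, ?_⟩
    -- The closure is a ring, so `x ^ (n + 1)` lies in it and also multiplies `y` into `A_i`.
    have heq : (⟨x * y, hmul x hx y hy⟩ : chain J i) ^ (n + 1) =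
        ⟨x ^ (n + 1) * y, hmul _ (pow_mem hx _) y hy⟩ * ⟨y, hyB⟩ ^ n := by
      apply Subtype.ext
      simp only [MulMemClass.coe_mul, SubmonoidClass.coe_pow]
      ring
    rw [heq]
    exact Ideal.mul_mem_left _ _ hn

/-- In a local ring of depth at least two, a fraction `c / b` with `𝔪 c ⊆ (b)` lies in the
ring. -/
theorem dvd_of_two_le_depth {R : Type u} [CommRing R] [IsLocalRing R] (h : 2 ≤ depth R)
    {b c : R} (hb : b ∈ nonZeroDivisors R) (hc : ∀ r ∈ IsLocalRing.maximalIdeal R, b ∣ r * c) :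
    b ∣ c := by
  have h1 : (1 : ℕ∞) < depth R := lt_of_lt_of_le (by norm_num) h
  simp only [depth, lt_iSup_iff] at h1
  obtain ⟨rs, ⟨hrs, hreg⟩, hlen⟩ := h1
  match rs, hrs, hreg, hlen with
  | [], _, _, hlen => simp at hlen
  | [_], _, _, hlen => simp at hlen
  | r₁ :: r₂ :: rs, hrs, hreg, _ =>
    rw [RingTheory.Sequence.isRegular_cons_iff, RingTheory.Sequence.isRegular_cons_iff] at hreg
    obtain ⟨h₁, h₂, -⟩ := hreg
    obtain ⟨p, hp⟩ := hc r₁ (hrs _ (by simp))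
    obtain ⟨q, hq⟩ := hc r₂ (hrs _ (by simp))
    -- As `r₂` is regular modulo `r₁`, this relation forces `r₁ ∣ p`; cancelling `r₁` in `r₁ * c = b
    -- * p` gives `b ∣ c`.
    have hpq : r₂ * p = r₁ * q := by
      apply mul_cancel_left_mem_nonZeroDivisors hb |>.mp
      linear_combination r₁ * hq - r₂ * hp
    have hmem : p ∈ (r₁ • ⊤ : Submodule R R) := by
      rw [← Submodule.Quotient.mk_eq_zero]
      apply h₂
      simp only [smul_zero]
      rw [← Submodule.Quotient.mk_smul, Submodule.Quotient.mk_eq_zero, smul_eq_mul, hpq]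
      exact Submodule.smul_mem_pointwise_smul q r₁ ⊤ trivial
    obtain ⟨w, -, hw⟩ := hmem
    refine ⟨w, h₁ ?_⟩
    have hw' : r₁ * w = p := hw
    simp only [smul_eq_mul]
    linear_combination hp - b * hw'

/-- If `a / b ∉ A`, some associated prime `P` of `A / (b)` contains the annihilator of the class of
`a`. Then `P` has height at least two, so `A_P` has depth at least two, while `P` annihilates a
nonzero class `c` modulo `b`, against `dvd_of_two_le_depth`. -/
theorem codimOneClosure_bot_le [IsNoetherianRing A] (hS : SerreS 2 A) :
    codimOneClosure (⊥ : Subalgebra A (FractionRing A)) ≤ ⊥ := by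
  intro x hx
  obtain ⟨a, b, rfl⟩ := IsLocalization.exists_mk'_eq (nonZeroDivisors A) x
  by_contra hmem
  have hiff : ∀ s : A, s • IsLocalization.mk' (FractionRing A) a b ∈
      (⊥ : Subalgebra A (FractionRing A)) ↔ (b : A) ∣ s * a := by
    intro s
    rw [Algebra.mem_bot, Algebra.smul_def, IsLocalization.mul_mk'_eq_mk'_of_mul]
    constructor
    · rintro ⟨z, hz⟩
      refine ⟨z, IsFractionRing.injective A (FractionRing A) ?_⟩
      rw [eq_comm, IsLocalization.mk'_eq_iff_eq_mul] at hz
      rw [hz, map_mul, mul_comm]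
    · rintro ⟨z, hz⟩
      exact ⟨z, by rw [eq_comm, IsLocalization.mk'_eq_iff_eq_mul, hz, map_mul, mul_comm]⟩
  have ha : Ideal.Quotient.mk (Ideal.span {(b : A)}) a ≠ 0 := by
    intro h0
    rw [Ideal.Quotient.eq_zero_iff_mem, Ideal.mem_span_singleton] at h0
    exact hmem (by simpa using (hiff 1).mpr (by simpa using h0))
  obtain ⟨P, hP, hle⟩ := exists_le_isAssociatedPrime_of_isNoetherianRing A _ ha
  rw [isAssociatedPrime_iff] at hP
  obtain ⟨hPp, c, hc⟩ := hP
  obtain ⟨c, rfl⟩ := Ideal.Quotient.mk_surjective c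
  have hmemP : ∀ r : A, r ∈ P ↔ (b : A) ∣ r * c := by
    intro r
    rw [hc, Submodule.mem_colon_singleton, Submodule.mem_bot, ← Ideal.mem_span_singleton,
      ← Ideal.Quotient.eq_zero_iff_mem, map_mul]
    rfl
  have hht : ¬ P.height ≤ 1 := by
    intro hht
    obtain ⟨s, hs, hsx⟩ := hx P hht
    refine hs (hle ?_)
    rw [Submodule.mem_colon_singleton, Submodule.mem_bot]
    rw [hiff, ← Ideal.mem_span_singleton, ← Ideal.Quotient.eq_zero_iff_mem, map_mul] at hsx
    exact hsx
  have hdepth : 2 ≤ depth (Localization.AtPrime P) := by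
    have h := hS ⟨P, hPp⟩
    change min _ (ringKrullDim (Localization.AtPrime P)) ≤ _ at h
    rw [IsLocalization.AtPrime.ringKrullDim_eq_height P, min_eq_left] at h
    · exact_mod_cast h
    · have : (2 : ℕ∞) ≤ P.height := by
        have := Order.add_one_le_of_lt (not_le.mp hht)
        rwa [one_add_one_eq_two] at this
      exact_mod_cast this
  have hdvd : algebraMap A (Localization.AtPrime P) b ∣ algebraMap A _ c := by
    refine dvd_of_two_le_depth hdepth ?_ fun r hr => ?_
    · exact IsLocalization.map_nonZeroDivisors_le P.primeCompl _ ⟨b, b.2, rfl⟩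
    · obtain ⟨r, s, rfl⟩ := IsLocalization.exists_mk'_eq P.primeCompl r
      rw [IsLocalization.AtPrime.mk'_mem_maximal_iff _ P, hmemP] at hr
      obtain ⟨z, hz⟩ := hr
      refine ⟨IsLocalization.mk' _ z s, ?_⟩
      rw [mul_comm, IsLocalization.mul_mk'_eq_mk'_of_mul, IsLocalization.mul_mk'_eq_mk'_of_mul,
        mul_comm c, hz]
  obtain ⟨z, hz⟩ := hdvd
  obtain ⟨z, s, rfl⟩ := IsLocalization.exists_mk'_eq P.primeCompl z
  rw [IsLocalization.mul_mk'_eq_mk'_of_mul, IsLocalization.eq_mk'_iff_mul_eq, ← map_mul] at hz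
  obtain ⟨t, ht⟩ := (IsLocalization.eq_iff_exists P.primeCompl _).mp hz
  have : (t * s : A) ∈ P := (hmemP _).mpr ⟨t * z, by linear_combination ht⟩
  exact hPp.mul_notMem t.2 s.2 this

/-! ### The singular locus -/

theorem notMem_sing_of_mem_minimalPrimes [IsReduced A] (P : PrimeSpectrum A)
    (hP : P.asIdeal ∈ minimalPrimes A) : P ∉ Sing A := by
  have : Ring.KrullDimLE 0 (Localization.AtPrime P.asIdeal) := .of_isLocalization _ hP _
  let : Field (Localization.AtPrime P.asIdeal) := Ring.KrullDimLE.isField_of_isReduced.toField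
  exact not_not.mpr (inferInstance : IsRegularLocalRing (Localization.AtPrime P.asIdeal))

theorem vanishingIdeal_le_iff_mem_sing (hcl : IsClosed (Sing A)) (P : PrimeSpectrum A) :
    PrimeSpectrum.vanishingIdeal (Sing A) ≤ P.asIdeal ↔ P ∈ Sing A := by
  rw [← SetLike.coe_subset_coe, ← PrimeSpectrum.mem_zeroLocus,
    PrimeSpectrum.zeroLocus_vanishingIdeal_eq_closure, hcl.closure_eq]

theorem exists_nonZeroDivisor_mem_vanishingIdeal [IsReduced A] [IsNoetherianRing A]
    (hcl : IsClosed (Sing A)) :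
    ∃ g ∈ nonZeroDivisors A, g ∈ PrimeSpectrum.vanishingIdeal (Sing A) := by
  by_contra! h
  have hsub : (PrimeSpectrum.vanishingIdeal (Sing A) : Set A) ⊆
      ⋃ p ∈ minimalPrimes A, ((id p : Ideal A) : Set A) := by
    intro g hg
    have hg' : ∃ y, y * g = 0 ∧ y ≠ 0 := by
      by_contra! hy
      exact h g (mem_nonZeroDivisors_iff_right.mpr hy) hg
    obtain ⟨y, hy, hy0⟩ := hg'
    change g ∈ ⋃ p ∈ (⊥ : Ideal A).minimalPrimes, (p : Set A)
    rw [Ideal.iUnion_minimalPrimes]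
    have hrad : (⊥ : Ideal A).radical = ⊥ := nilradical_eq_zero A
    exact ⟨y, by simpa [hrad] using hy0, by simpa [hrad, mul_comm] using hy⟩
  -- Prime avoidance tolerates two non-prime members; all are prime here, so `⊥ ⊥` are placeholders.
  obtain ⟨p, hp, hle⟩ := (Ideal.subset_union_prime_finite
    (minimalPrimes.finite_of_isNoetherianRing A) ⊥ ⊥ fun p hp _ _ => hp.1.1).mp hsub
  exact notMem_sing_of_mem_minimalPrimes ⟨p, hp.1.1⟩ hp
    ((vanishingIdeal_le_iff_mem_sing hcl ⟨p, hp.1.1⟩).mp hle)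

theorem vanishingIdeal_le_idealAt (P : PrimeSpectrum A) :
    PrimeSpectrum.vanishingIdeal (Sing A) ≤ idealAt A P :=
  le_iInf₂ fun _ hP' _ ha => (PrimeSpectrum.mem_vanishingIdeal _ _).mp ha _ hP'.1

theorem idealAt_eq_top (hcl : IsClosed (Sing A)) {P : PrimeSpectrum A} (hP : P ∉ Sing A) :
    idealAt A P = ⊤ := by
  refine top_le_iff.mp (le_iInf₂ fun P' hP' => absurd ?_ hP)
  rw [← vanishingIdeal_le_iff_mem_sing hcl] at hP' ⊢
  exact hP'.1.trans hP'.2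

theorem mem_sing_of_mem_minimalPrimes_vanishingIdeal (hcl : IsClosed (Sing A)) {p : Ideal A}
    (hp : p ∈ (PrimeSpectrum.vanishingIdeal (Sing A)).minimalPrimes) :
    (⟨p, hp.1.1⟩ : PrimeSpectrum A) ∈ Sing A :=
  (vanishingIdeal_le_iff_mem_sing hcl _).mp hp.1.2

theorem idealAt_eq_sInf_minimalPrimes (hcl : IsClosed (Sing A)) (P : PrimeSpectrum A) :
    idealAt A P =
      sInf {p ∈ (PrimeSpectrum.vanishingIdeal (Sing A)).minimalPrimes | p ≤ P.asIdeal} := by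
  refine le_antisymm (le_sInf fun p hp => ?_) (le_iInf₂ fun P' hP' => ?_)
  · exact iInf₂_le (⟨p, hp.1.1.1⟩ : PrimeSpectrum A)
      ⟨mem_sing_of_mem_minimalPrimes_vanishingIdeal hcl hp.1, hp.2⟩
  · obtain ⟨p, hp, hle⟩ := Ideal.exists_minimalPrimes_le
      ((vanishingIdeal_le_iff_mem_sing hcl P').mpr hP'.1)
    exact sInf_le_of_le ⟨hp, hle.trans hP'.2⟩ hle

theorem finite_strata [IsNoetherianRing A] (hcl : IsClosed (Sing A)) : (Strata A).Finite := by
  refine Set.Finite.image _ (Set.Finite.subset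
    ((Ideal.finite_minimalPrimes_of_isNoetherianRing A
      (PrimeSpectrum.vanishingIdeal (Sing A))).finite_subsets.image sInf) ?_)
  rintro _ ⟨P, -, rfl⟩
  exact ⟨_, Set.sep_subset _ _, (idealAt_eq_sInf_minimalPrimes hcl P).symm⟩

/-- `J` is the intersection of its finitely many minimal primes, and `L_P` that of those inside `P`.
An `s ∉ P` lying in all the others multiplies `L_P` into `J`. -/
theorem locLE_idealAt [IsNoetherianRing A] (hcl : IsClosed (Sing A)) (P : PrimeSpectrum A) :
    LocLE P.asIdeal (idealAt A P) (PrimeSpectrum.vanishingIdeal (Sing A)) := by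
  set J := PrimeSpectrum.vanishingIdeal (Sing A)
  have hfin : {p ∈ J.minimalPrimes | ¬ p ≤ P.asIdeal}.Finite :=
    (Ideal.finite_minimalPrimes_of_isNoetherianRing A J).subset (Set.sep_subset _ _)
  obtain ⟨s, hsmem, hs⟩ : ∃ s ∈ hfin.toFinset.inf id, s ∉ P.asIdeal := by
    rw [← SetLike.not_le_iff_exists, P.2.inf_le']
    rintro ⟨p, hp, hle⟩
    exact (hfin.mem_toFinset.mp hp).2 hle
  intro a ha
  refine ⟨s, hs, ?_⟩
  have hrad : J.radical = J := PrimeSpectrum.isRadical_vanishingIdeal _ |>.radical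
  rw [← hrad, ← Ideal.sInf_minimalPrimes, Submodule.mem_sInf]
  intro p hp
  rw [smul_eq_mul]
  by_cases hle : p ≤ P.asIdeal
  · rw [idealAt_eq_sInf_minimalPrimes hcl, Submodule.mem_sInf] at ha
    exact Ideal.mul_mem_left p s (ha p ⟨hp, hle⟩)
  · have : hfin.toFinset.inf id ≤ p := Finset.inf_le (f := id) (hfin.mem_toFinset.mpr ⟨hp, hle⟩)
    exact Ideal.mul_mem_right a p (this hsmem)

/-- A prime strictly below `Q` is minimal, hence regular because `A` is reduced. -/
theorem idealAt_eq_self [IsReduced A] {Q : PrimeSpectrum A} (hQ : Q ∈ Sing A)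
    (hht : Q.asIdeal.height ≤ 1) : idealAt A Q = Q.asIdeal := by
  refine le_antisymm (iInf₂_le Q ⟨hQ, le_rfl⟩) (le_iInf₂ fun P' hP' => ?_)
  by_contra hlt
  have hlt : P'.asIdeal < Q.asIdeal := lt_of_le_not_ge hP'.2 hlt
  have h0 : P'.asIdeal.height = 0 := by
    have h := (Ideal.height_add_one_le_of_lt_of_isPrime hlt).trans hht
    exact Order.lt_one_iff.mp ((ENat.add_one_le_iff' ENat.one_ne_top).mp h)
  rw [Ideal.height_eq_zero_iff] at h0
  exact notMem_sing_of_mem_minimalPrimes P' h0 hP'.1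

/-! ### Comparison of the numbers of steps -/

theorem chain_idealAt_locLE [IsReduced A] [IsNoetherianRing A] (hcl : IsClosed (Sing A))
    (P : PrimeSpectrum A) (i : ℕ) :
    LocLE P.asIdeal (chain (PrimeSpectrum.vanishingIdeal (Sing A)) i).toSubmodule
      (chain (idealAt A P) i).toSubmodule ∧
    LocLE P.asIdeal (chain (idealAt A P) i).toSubmodule
      (chain (PrimeSpectrum.vanishingIdeal (Sing A)) i).toSubmodule := by
  obtain ⟨g, hg, hgJ⟩ := exists_nonZeroDivisor_mem_vanishingIdeal hcl
  have hle := vanishingIdeal_le_idealAt P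
  exact ⟨(LocLE.of_le hle).chain (locLE_idealAt hcl P) hg hgJ hg (hle hgJ) i,
    (locLE_idealAt hcl P).chain (.of_le hle) hg (hle hgJ) hg hgJ i⟩

theorem numSteps_vanishingIdeal_le [IsReduced A] [IsNoetherianRing A]
    (hcl : IsClosed (Sing A)) {n : ℕ}
    (hn : ∀ P ∈ Sing A, numSteps A (idealAt A P) ≤ n) :
    numSteps A (PrimeSpectrum.vanishingIdeal (Sing A)) ≤ n := by
  rw [numSteps_le_iff]
  refine le_antisymm (chain_le_succ _ n) ?_
  refine Subalgebra.toSubmodule.le_iff_le.mp (le_of_forall_locLE fun Q hQ => ?_)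
  have heq : chain (idealAt A ⟨Q, hQ⟩) n = chain (idealAt A ⟨Q, hQ⟩) (n + 1) := by
    by_cases hs : (⟨Q, hQ⟩ : PrimeSpectrum A) ∈ Sing A
    · exact numSteps_le_iff.mp (hn _ hs)
    · rw [idealAt_eq_top hcl hs, chain_top, chain_top]
  have h := (chain_idealAt_locLE hcl ⟨Q, hQ⟩ (n + 1)).1
  rw [← heq] at h
  exact h.trans (chain_idealAt_locLE hcl ⟨Q, hQ⟩ n).2

theorem numSteps_le_of_vanishingIdeal_le [IsReduced A] [IsNoetherianRing A]
    (hcl : IsClosed (Sing A)) (hS : SerreS 2 A) {L : Ideal A}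
    (hL : PrimeSpectrum.vanishingIdeal (Sing A) ≤ L) :
    numSteps A L ≤ numSteps A (PrimeSpectrum.vanishingIdeal (Sing A)) := by
  obtain ⟨g, hg, hgJ⟩ := exists_nonZeroDivisor_mem_vanishingIdeal hcl
  refine le_of_forall_natCast_le fun n hn => ?_
  rw [numSteps_le_iff] at hn ⊢
  refine le_antisymm (chain_le_succ L n) fun x hx => ?_
  refine codimOneClosure_chain_le (codimOneClosure_bot_le hS) L n fun Q hQ hht => ?_
  by_cases hLQ : L ≤ Q
  · have hQs : (⟨Q, hQ⟩ : PrimeSpectrum A) ∈ Sing A :=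
      (vanishingIdeal_le_iff_mem_sing hcl _).mp (hL.trans hLQ)
    have hLJ : LocLE Q L (PrimeSpectrum.vanishingIdeal (Sing A)) :=
      (LocLE.of_le (hLQ.trans_eq (idealAt_eq_self hQs hht).symm)).trans (locLE_idealAt hcl ⟨Q, hQ⟩)
    have h₁ := hLJ.chain (.of_le hL) hg (hL hgJ) hg hgJ (n + 1)
    rw [← hn] at h₁
    exact h₁.trans ((LocLE.of_le hL).chain hLJ hg hgJ hg (hL hgJ) n) x hx
  · obtain ⟨l, hl, hlQ⟩ := SetLike.not_le_iff_exists.mp hLQ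
    have htop : LocLE Q ⊤ L := fun a _ => ⟨l, hlQ, L.mul_mem_right a hl⟩
    have h := (LocLE.of_le le_top).chain htop hg (hL hgJ) (one_mem _) trivial (n + 1) x hx
    rw [chain_top] at h
    obtain ⟨s, hs, hsx⟩ := h
    exact ⟨s, hs, (bot_le : ⊥ ≤ chain L n) hsx⟩

end StratNorm

theorem mainTheorem2 (A : Type u) [CommRing A] [IsReduced A] (hA : StratNorm.IsExcellentRing A) :
    (StratNorm.Strata A).Finite ∧
    StratNorm.numSteps A (PrimeSpectrum.vanishingIdeal (StratNorm.Sing A)) ≤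
      (⨆ W ∈ StratNorm.Strata A, StratNorm.numSteps A (StratNorm.stratumIdeal A W)) ∧
    (StratNorm.IsEquidimensional A → StratNorm.SerreS 2 A →
      StratNorm.numSteps A (PrimeSpectrum.vanishingIdeal (StratNorm.Sing A)) =
        ⨆ W ∈ StratNorm.Strata A, StratNorm.numSteps A (StratNorm.stratumIdeal A W)) := by
  have := hA.isNoetherianRing
  have hcl : IsClosed (StratNorm.Sing A) := ⟨hA.isOpen_regularLocus A⟩
  have hle : StratNorm.numSteps A (PrimeSpectrum.vanishingIdeal (StratNorm.Sing A)) ≤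
      (⨆ W ∈ StratNorm.Strata A, StratNorm.numSteps A (StratNorm.stratumIdeal A W)) := by
    -- An empty supremum in `ℕ∞` is `0`, so regular `A` needs no separate case.
    refine StratNorm.le_of_forall_natCast_le fun n hn =>
      StratNorm.numSteps_vanishingIdeal_le hcl fun P hP => ?_
    have hW : StratNorm.stratum A (StratNorm.idealAt A P) ∈ StratNorm.Strata A :=
      ⟨_, ⟨P, hP, rfl⟩, rfl⟩
    rw [← StratNorm.stratumIdeal_eq A hW ⟨hP, rfl⟩]
    exact (le_iSup₂_of_le _ hW le_rfl).trans hn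
  refine ⟨StratNorm.finite_strata hcl, hle, fun _ hS => le_antisymm hle (iSup₂_le fun W _ => ?_)⟩
  refine StratNorm.numSteps_le_of_vanishingIdeal_le hcl hS (le_iInf₂ fun P _ => ?_)
  exact StratNorm.vanishingIdeal_le_idealAt P
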